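/- \textbf{Setting.} Let $S^5\subset\mathbb C^3$ be the unit sphere with the coordinatewise action of $T^3=(S^1)^3$. For nonzero integers $a,b,c$ with $\gcd(a,b,c)=1$ let $T^1_{a,b,c}=\{(\lambda^a,\lambda^b,\lambda^c):\lambda\in S^1\}\subset T^3$. The weighted complex projective space is $\mathbb{CP}^2_{a,b,c}=S^5/T^1_{a,b,c}$; it carries the induced action of the $2$-torus $T^3/T^1_{a,b,c}$. \textbf{Invariants.} Let the circle $T^1$ act continuously on an oriented $4$-space $X$ such that $\bar X=X/T^1$ is homeomorphic to $S^3$. Orient $\bar X$ so that its orientation followed by that of the orbits is the orientation of $X$. Suppose that there are exactly three fixed points $p_1,p_2,p_3$ and that all nonfree orbits lie over a locally flat unknotted closed curve $\bar c\subset\bar X$, i.e. one which an orientation-preserving homeomorphism $\bar X\cong S^3$ takes to the standard unknot. Label the points so that the oriented curve $\bar c$ traverses $(\bar p_1,\bar p_2,\bar p_3)$, let $J_i$ be the open arc of $\bar c$ from $\bar p_i$ to $\bar p_{i+1}$ (indices mod $3$), and let $\bar V_i\subset\bar X$ be a disk meeting $\bar c$ transversally in one point, lying in $J_i$, oriented so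 that $\bar V_i\cdot J_i=+1$, with boundary oriented as the boundary of $\bar V_i$ (counterclockwise). Let $\sigma$ be a section of the action over $\bar X\setminus\bar c$, put $q_i=\sigma(\partial\bar V_i)$, and let $h$ be an oriented free orbit. The action has \emph{invariants} $\left(\frac{\beta_1}{\alpha_1},\frac{\beta_2}{\alpha_2},\frac{\beta_3}{\alpha_3}\right)\in\mathbb Q^3$ (with respect to $\sigma$ and the labeling), where the fractions are in lowest terms and $\alpha_i>0$, if for each $i$ the orbits over $J_i$ have isotropy group of order $\alpha_i$, and the curve $m_i=\alpha_i q_i+\beta_i h$ on the torus over $\partial\bar V_i$ is a meridian, i.e. bounds a disk in the solid torus over $\bar V_i$. \textbf{Theorem (Existence).} Let $\left(\frac{\beta_1}{\alpha_1},\frac{\beta_2}{\alpha_2},\frac{\beta_3}{\alpha_3}\right)\in\mathbb Q^3$ be a triple whose three fractions are pairwise unequal. Then there are nonzero integers $a,b,c$ with $\gcd(a,b,c)=1$, a finite subgroup $\Gamma$ of the torus $T^3/T^1_{a,b,c}$, and a continuous homomorphism $\rho$ from $T^1$ to the torus $(T^3/T^1_{a,b,c})/\Gamma$, such that, for a suitable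 orientation of $\mathbb{CP}^2_{a,b,c}/\Gamma$, the circle action on $\mathbb{CP}^2_{a,b,c}/\Gamma$ defined by $\rho$ (and thus induced from the action of $T^3$ on $S^5$) has the invariants $\left(\frac{\beta_1}{\alpha_1},\frac{\beta_2}{\alpha_2},\frac{\beta_3}{\alpha_3}\right)$ with respect to some section and some labeling. -/

import Mathlib

open scoped BigOperators

noncomputable section

namespace WeightedCP2

/-! ### Induced actions on orbit spaces -/

section QuotientAction

variable {G X : Type*} [CommGroup G] [MulAction G X]

/-- If a commutative group `G` acts on `X` and `H` is a subgroup, then `G ⧸ H` acts on the orbit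
space `X / H`, by `[g] • [x] = [g • x]`. -/
instance quotientMulAction (H : Subgroup G) :
    MulAction (G ⧸ H) (MulAction.orbitRel.Quotient H X) where
  smul a y :=
    Quotient.map₂ (sa := QuotientGroup.leftRel H) (sb := MulAction.orbitRel H X)
      (sc := MulAction.orbitRel H X) (fun (g : G) (x : X) => g • x) (by
        intro g g' hg x x' hx
        obtain ⟨k, hk⟩ := hx
        have hg' : g⁻¹ * g' ∈ H := QuotientGroup.leftRel_apply.mp hg
        refine ⟨⟨(g⁻¹ * g')⁻¹ * k, H.mul_mem (H.inv_mem hg') k.2⟩, ?_⟩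
        have hk' : (k : G) • x' = x := hk
        change ((g⁻¹ * g')⁻¹ * (k : G)) • (g' • x') = g • x
        rw [← hk', smul_smul, smul_smul]
        congr 1
        rw [mul_inv_rev, inv_inv]
        rw [mul_comm (g'⁻¹ * g), mul_assoc, mul_comm (g'⁻¹ * g), ← mul_assoc g', mul_inv_cancel,
          one_mul, mul_comm]) a y
  one_smul y := by
    induction y using Quotient.inductionOn with
    | _ x => exact congrArg (Quotient.mk (MulAction.orbitRel H X)) (one_smul G x)
  mul_smul a b y := by
    induction a using Quotient.inductionOn with
    | _ g =>
      induction b using Quotient.inductionOn with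
      | _ g' =>
        induction y using Quotient.inductionOn with
        | _ x => exact congrArg (Quotient.mk (MulAction.orbitRel H X)) (mul_smul g g' x)

theorem quotient_smul_mk (H : Subgroup G) (g : G) (x : X) :
    ((g : G ⧸ H) • (Quotient.mk (MulAction.orbitRel H X) x : MulAction.orbitRel.Quotient H X)) =
      Quotient.mk (MulAction.orbitRel H X) (g • x) := rfl

instance quotientContinuousSMul [TopologicalSpace G] [IsTopologicalGroup G] [TopologicalSpace X]
    [ContinuousSMul G X] (H : Subgroup G) :
    ContinuousSMul (G ⧸ H) (MulAction.orbitRel.Quotient H X) where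
  continuous_smul := by
    have h1 : IsOpenQuotientMap (QuotientGroup.mk : G → G ⧸ H) :=
      QuotientGroup.isOpenQuotientMap_mk
    have h2 : IsOpenQuotientMap (Quotient.mk (MulAction.orbitRel H X)) :=
      MulAction.isOpenQuotientMap_quotientMk
    refine (h1.prodMap h2).isQuotientMap.continuous_iff.mpr ?_
    exact h2.continuous.comp (continuous_smul (M := G) (X := X))

end QuotientAction

/-! ### Weighted complex projective planes and their finite quotients -/

/-- The unit sphere `S⁵` in `ℂ³`. -/
abbrev S5 : Type := Metric.sphere (0 : EuclideanSpace ℂ (Fin 3)) 1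

/-- The torus `T³`. -/
abbrev T3 : Type := Fin 3 → Circle

/-- The standard action of `T³` on `S⁵`, by multiplication in each coordinate. -/
instance torusAction : MulAction T3 S5 where
  smul t x := ⟨WithLp.toLp 2 fun i => (t i : ℂ) * x.1 i, by
    have h := x.2
    rw [mem_sphere_zero_iff_norm, EuclideanSpace.norm_eq] at h ⊢
    simpa only [norm_mul, Circle.norm_coe, one_mul] using h⟩
  one_smul x := by
    apply Subtype.ext
    ext i
    change ((1 : Circle) : ℂ) * x.1 i = x.1 i
    simp
  mul_smul s t x := by
    apply Subtype.ext
    ext i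
    change ((s i * t i : Circle) : ℂ) * x.1 i = (s i : ℂ) * ((t i : ℂ) * x.1 i)
    simp [mul_assoc]

theorem torus_smul_apply (t : T3) (x : S5) (i : Fin 3) : (t • x).1 i = (t i : ℂ) * x.1 i := rfl

instance torusContinuousSMul : ContinuousSMul T3 S5 where
  continuous_smul := by
    refine Continuous.subtype_mk ?_ _
    refine (PiLp.continuous_toLp 2 _).comp ?_
    fun_prop

/-- The subgroup `T¹_{a,b,c} = {(λᵃ, λᵇ, λᶜ)}` of `T³`, where `w = (a, b, c)`. -/
def T1 (w : Fin 3 → ℤ) : Subgroup T3 :=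
  MonoidHom.range
    ({ toFun := fun l i => l ^ w i
       map_one' := by ext i; simp
       map_mul' := fun l m => by funext i; exact mul_zpow l m (w i) } : Circle →* T3)

/-- The 2-torus `T³ / T¹_{a,b,c}`. -/
abbrev T2 (w : Fin 3 → ℤ) : Type := T3 ⧸ T1 w

/-- The weighted complex projective space `ℂP²_{a,b,c} = S⁵ / T¹_{a,b,c}`. It carries the induced
action of `T2 w`. -/
abbrev CP2 (w : Fin 3 → ℤ) : Type := MulAction.orbitRel.Quotient (T1 w) S5

/-- The quotient `ℂP²_{a,b,c} / Γ` by a group `Γ` of transformations from the torus `T2 w`. It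
carries the induced action of the torus `T2 w ⧸ Γ`. -/
abbrev CP2Quotient {w : Fin 3 → ℤ} (Γ : Subgroup (T2 w)) : Type :=
  MulAction.orbitRel.Quotient Γ (CP2 w)

/-- The space `ℂP²_{a,b,c} / Γ` with the circle action that a homomorphism from the circle into
the torus `T2 w ⧸ Γ` (a quotient of `T³`) defines. -/
def CircleSpace {w : Fin 3 → ℤ} {Γ : Subgroup (T2 w)} (_ρ : Circle →ₜ* (T2 w ⧸ Γ)) : Type :=
  CP2Quotient Γ

section CircleSpace

variable {w : Fin 3 → ℤ} {Γ : Subgroup (T2 w)} (ρ : Circle →ₜ* (T2 w ⧸ Γ))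

instance : TopologicalSpace (CircleSpace ρ) := inferInstanceAs (TopologicalSpace (CP2Quotient Γ))

instance : MulAction Circle (CircleSpace ρ) :=
  MulAction.compHom (CP2Quotient Γ) (ρ : Circle →* (T2 w ⧸ Γ))

theorem circleSpace_smul (c : Circle) (p : CircleSpace ρ) :
    c • p = (show CP2Quotient Γ from (ρ c • (show CP2Quotient Γ from p))) := rfl

instance : ContinuousSMul Circle (CircleSpace ρ) where
  continuous_smul := by
    have h : Continuous fun q : Circle × CP2Quotient Γ => ρ q.1 • q.2 :=
      continuous_smul.comp (((map_continuous ρ).comp continuous_fst).prodMk continuous_snd)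
    exact h

end CircleSpace

/-! ### Invariants of circle actions -/

/-- The unit sphere `S³` in `ℂ²`, with its standard orientation. -/
abbrev S3 : Type := Metric.sphere (0 : EuclideanSpace ℂ (Fin 2)) 1

/-- The point `(e^{2πij/3}, 0)` on the standard unknot `{(z, 0)} ⊆ S³`. -/
def IsVertex (j : Fin 3) (y : S3) : Prop :=
  y.1 0 = (Circle.exp (2 * Real.pi * (j : ℕ) / 3) : ℂ) ∧ y.1 1 = 0

/-- The open arc `J_j` of the standard unknot from the `j`-th to the `(j+1)`-st vertex. -/
def arc (j : Fin 3) : Set S3 :=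
  {y | y.1 1 = 0 ∧ ∃ θ ∈ Set.Ioo (2 * Real.pi * (j : ℕ) / 3) (2 * Real.pi * ((j : ℕ) + 1) / 3),
    y.1 0 = (Circle.exp θ : ℂ)}

/-- The complement of the standard unknot in `S³`. -/
abbrev UnknotCompl : Type := {y : S3 // y.1 1 ≠ 0}

/-- The midpoint of the arc `J_j`, as a complex number of modulus one. -/
def mid (j : Fin 3) : Circle := Circle.exp (2 * Real.pi * ((j : ℕ) + 1 / 2) / 3)

/-- A closed disk `V_j` in `S³` that meets the standard unknot transversally, in the single point
`(mid j, 0)`. The coordinate `y.1 1` identifies it with the disk of radius `3/5` in `ℂ`. With the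
orientation of `ℂ` its intersection number with `J_j` is `+1`. -/
def meridianDisk (j : Fin 3) : Set S3 :=
  {y | y.1 0 = (‖y.1 0‖ : ℂ) * (mid j : ℂ) ∧ ‖y.1 1‖ ≤ 3 / 5}

/-- The boundary of the disk `V_j`, parametrized by the circle in the positive direction. -/
def meridian (j : Fin 3) (c : Circle) : UnknotCompl :=
  ⟨⟨!₂[4 / 5 * (mid j : ℂ), 3 / 5 * (c : ℂ)], by
    rw [mem_sphere_zero_iff_norm, EuclideanSpace.norm_eq, Real.sqrt_eq_one]
    norm_num [Fin.sum_univ_two, Circle.norm_coe]⟩, by simp⟩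

section Invariants

variable (X : Type*) [TopologicalSpace X] [MulAction Circle X]

/-- The orbit space `X / T¹`. -/
abbrev OrbitSpace : Type _ := MulAction.orbitRel.Quotient Circle X

/-- Two homeomorphisms of the orbit space with `S³` induce the same orientation iff they are
homotopic, that is, iff their quotient has degree one. -/
instance orientationSetoid : Setoid (OrbitSpace X ≃ₜ S3) where
  r φ ψ := ContinuousMap.Homotopic (φ : C(OrbitSpace X, S3)) (ψ : C(OrbitSpace X, S3))
  iseqv := ⟨fun _ => ContinuousMap.Homotopic.refl _, fun h => h.symm, fun h h' => h.trans h'⟩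

/-- An orientation of a 4-space with a circle action whose orbit space is a 3-sphere. It is given
by an orientation of the orbit space, which, followed by the orientation of the orbits, is the
orientation of the 4-space. -/
def ActionOrientation : Type _ := Quotient (orientationSetoid X)

variable {X}

/-- `HasInvariants o x`: the circle action on the space `X` with the orientation `o` has the
invariants `(x 0, x 1, x 2)`, with respect to some section and some labeling of the curve.

The homeomorphism `φ` is an orientation-preserving identification of the orbit space with `S³`. It
identifies the closed curve that contains the singular set (which is thus locally flat and
unknotted) with the standard unknot, traversed in the direction of the labeling. The orbits off the
curve are free, the three vertices are the images of the fixed points, and the orbits over the arc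
`J_i` have an isotropy group of order `αᵢ`, where `x i = βᵢ / αᵢ` in lowest terms. The map `σ` is a
section of the action over the complement of the curve. Over the boundary of the disk `V_i` it gives
a curve `qᵢ`, and with `h` an oriented orbit the curve `mᵢ = αᵢ qᵢ + βᵢ h` is a meridian of the
solid torus over `V_i`: it bounds a disk there. -/
def HasInvariants [ContinuousSMul Circle X] (o : ActionOrientation X) (x : Fin 3 → ℚ) : Prop :=
  ∃ φ : OrbitSpace X ≃ₜ S3,
    (Quotient.mk (orientationSetoid X) φ : ActionOrientation X) = o ∧
    (∀ p : X, (φ (Quotient.mk _ p)).1 1 ≠ 0 → MulAction.stabilizer Circle p = ⊥) ∧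
    (∀ (j : Fin 3) (p : X), IsVertex j (φ (Quotient.mk _ p)) →
      MulAction.stabilizer Circle p = ⊤) ∧
    (∀ (j : Fin 3) (p : X), φ (Quotient.mk _ p) ∈ arc j →
      Nat.card (MulAction.stabilizer Circle p) = (x j).den) ∧
    ∃ σ : C(UnknotCompl, X),
      (∀ y, φ (Quotient.mk _ (σ y)) = y.1) ∧
      ∀ j : Fin 3, ∃ D : C(Metric.closedBall (0 : ℂ) 1, X),
        (∀ u, φ (Quotient.mk _ (D u)) ∈ meridianDisk j) ∧
        ∀ c : Circle, D ⟨(c : ℂ), by simp [Circle.norm_coe]⟩ =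
          c ^ (x j).num • σ (meridian j (c ^ (x j).den))

end Invariants

end WeightedCP2

end

noncomputable section

namespace WeightedCP2

/-! ### The homomorphism from the torus given by the numerators and denominators -/

/-! Write `x i` as βᵢ/αᵢ. The meridian condition says which circle of T² collapses over the arc Jᵢ:
it should be c ↦ (c^βᵢ, c^αᵢ). So let T³ → T² (`torusHom`) be this map on the i-th coordinate
circle, which fixes the points of S⁵ with vᵢ = 0. The fractions are pairwise unequal exactly when
all 2×2 minors of the matrix with rows β and α are nonzero. Hence the map is onto, the cross product
of the rows divided by its gcd gives nonzero weights w, and the kernel K contains T¹_w with finite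
quotient Γ (`exists_weights`, `finite_ker_torusHomLift`). Then S⁵/K is ℂP²_w/Γ, the torus T³/K ≅ T²
acts on it, and ρ is the inclusion of the first factor.

The orbit space is the quotient of S⁵ by all t with ∏ tᵢ^αᵢ = 1. An explicit map S⁵ → S³ has these
orbits as fibres (`sphereMap_eq_iff`): the moduli determine a point of a half space by a piecewise
linear homeomorphism, and the product of the phases to the powers αᵢ turns the half space around its
boundary. The unknot is the image of the points with a vanishing coordinate: one on an arc, two at a
vertex.

The isotropy groups can now be read off from the matrix, with coprimality of βᵢ and αᵢ over an arc
and a nonzero minor at a vertex. Real points of S⁵, moved by the second factor of T², give the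
section. Rotating the coordinate vⱼ sweeps out a disk whose boundary is the required meridian
(`smul_realSection_meridian`). -/

theorem exists_circle_zpow_eq {n : ℤ} (hn : n ≠ 0) (a : Circle) : ∃ b : Circle, b ^ n = a := by
  obtain ⟨θ, rfl⟩ := Circle.exp_surjective a
  refine ⟨Circle.exp (θ / n), ?_⟩
  rw [← Circle.exp_intCast_mul, mul_div_cancel₀ _ (Int.cast_ne_zero.mpr hn)]

theorem natCard_circle_pow_eq_one (n : ℕ) [NeZero n] :
    Nat.card {c : Circle // c ^ n = 1} = n := by
  have e : rootsOfUnity n Circle ≃ {c : Circle // c ^ n = 1} :=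
    { toFun := fun c => ⟨(c : Circleˣ), by
        rw [← Units.val_pow_eq_pow_val, (mem_rootsOfUnity n _).mp c.2, Units.val_one]⟩
      invFun := fun c => rootsOfUnity.mkOfPowEq c.1 c.2
      left_inv := fun c => by ext; simp
      right_inv := fun c => by ext; simp }
  rw [← Nat.card_congr e, HasEnoughRootsOfUnity.natCard_rootsOfUnity Circle n]

theorem finite_circle_zpow_eq_one {n : ℤ} (hn : n ≠ 0) : {c : Circle | c ^ n = 1}.Finite := by
  have : NeZero n.natAbs := ⟨Int.natAbs_ne_zero.mpr hn⟩
  have : Finite {c : Circle // c ^ n.natAbs = 1} :=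
    Nat.finite_of_card_ne_zero (by rw [natCard_circle_pow_eq_one]; exact NeZero.ne _)
  refine (Set.finite_range (Subtype.val : {c : Circle // c ^ n.natAbs = 1} → Circle)).subset
    fun c hc => ⟨⟨c, ?_⟩, rfl⟩
  replace hc : c ^ n = 1 := hc
  rcases Int.natAbs_eq n with h | h
  · rwa [h, zpow_natCast] at hc
  · rwa [h, zpow_neg, inv_eq_one, zpow_natCast] at hc

/-- The homomorphism `T³ → T²` whose restriction to the `i`-th coordinate circle is
`c ↦ (c ^ βᵢ, c ^ αᵢ)`, where `x i = βᵢ / αᵢ` in lowest terms. -/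
def torusHom (x : Fin 3 → ℚ) : T3 →* Circle × Circle where
  toFun t := (∏ i, t i ^ (x i).num, ∏ i, t i ^ (x i).den)
  map_one' := by simp
  map_mul' s t := by simp [mul_zpow, mul_pow, Finset.prod_mul_distrib]

theorem torusHom_apply (x : Fin 3 → ℚ) (t : T3) :
    torusHom x t = (∏ i, t i ^ (x i).num, ∏ i, t i ^ (x i).den) := rfl

theorem continuous_torusHom (x : Fin 3 → ℚ) : Continuous (torusHom x) := by
  change Continuous fun t : T3 => (∏ i, t i ^ (x i).num, ∏ i, t i ^ (x i).den)
  fun_prop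

theorem torusHom_mulSingle (x : Fin 3 → ℚ) (i : Fin 3) (c : Circle) :
    torusHom x (Pi.mulSingle i c) = (c ^ (x i).num, c ^ (x i).den) := by
  rw [torusHom_apply, Finset.prod_eq_single i, Finset.prod_eq_single i]
  all_goals simp +contextual

/-- The determinant of the columns `i` and `k` of the matrix of `torusHom x`. -/
def colDet (x : Fin 3 → ℚ) (i k : Fin 3) : ℤ :=
  (x i).num * (x k).den - (x i).den * (x k).num

theorem colDet_ne_zero {x : Fin 3 → ℚ} {i k : Fin 3} (h : x i ≠ x k) : colDet x i k ≠ 0 := by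
  intro h0
  apply h
  rw [Rat.eq_iff_mul_eq_mul]
  unfold colDet at h0
  linarith

/-- Cramer's rule on the columns i and k, after extracting roots of order `colDet x i k`. The
support condition is what later produces elements of T³ fixing a point with two vanishing
coordinates. -/
theorem exists_torusHom_eq {x : Fin 3 → ℚ} {i k : Fin 3} (h : x i ≠ x k) (a : Circle × Circle) :
    ∃ t : T3, torusHom x t = a ∧ ∀ l, l ≠ i → l ≠ k → t l = 1 := by
  have hd := colDet_ne_zero h
  obtain ⟨a1, a2⟩ := a
  obtain ⟨b1, rfl⟩ := exists_circle_zpow_eq hd a1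
  obtain ⟨b2, rfl⟩ := exists_circle_zpow_eq hd a2
  -- The exponents are the entries of the adjugate of the 2×2 matrix of columns i and k.
  refine ⟨Pi.mulSingle i (b1 ^ ((x k).den : ℤ) * b2 ^ (-(x k).num)) *
    Pi.mulSingle k (b1 ^ (-((x i).den : ℤ)) * b2 ^ (x i).num), ?_, ?_⟩
  · rw [map_mul, torusHom_mulSingle, torusHom_mulSingle, Prod.mk_mul_mk]
    simp only [← zpow_natCast, mul_zpow, ← zpow_mul]
    ext1
    · simp only
      rw [mul_mul_mul_comm, ← zpow_add, ← zpow_add, colDet,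
        show -(x k).num * (x i).num + (x i).num * (x k).num = 0 by ring, zpow_zero, mul_one]
      congr 1
      ring
    · simp only
      rw [mul_mul_mul_comm, ← zpow_add, ← zpow_add, colDet,
        show ((x k).den : ℤ) * (x i).den + -((x i).den : ℤ) * (x k).den = 0 by ring, zpow_zero,
        one_mul]
      congr 1
      ring
  · intro l hi hk
    simp [hi, hk]

theorem torusHom_surjective {x : Fin 3 → ℚ} (hx : ∀ i j : Fin 3, i ≠ j → x i ≠ x j) :
    Function.Surjective (torusHom x) := fun a =>
  let ⟨t, ht, _⟩ := exists_torusHom_eq (hx 0 1 (by decide)) a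
  ⟨t, ht⟩

/-- The weights are the cross product of the rows of numerators and denominators, divided by its
gcd. It is orthogonal to both rows, and its entries are minors, hence nonzero. -/
theorem exists_weights {x : Fin 3 → ℚ} (hx : ∀ i j : Fin 3, i ≠ j → x i ≠ x j) :
    ∃ w : Fin 3 → ℤ, (∀ i, w i ≠ 0) ∧ Finset.univ.gcd w = 1 ∧
      ∑ i, w i * (x i).num = 0 ∧ ∑ i, w i * ((x i).den : ℤ) = 0 := by
  have h0 := colDet_ne_zero (hx 1 2 (by decide))
  have h1 := colDet_ne_zero (hx 2 0 (by decide))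
  have h2 := colDet_ne_zero (hx 0 1 (by decide))
  obtain ⟨w, hw, hg⟩ := Finset.extract_gcd (s := (Finset.univ : Finset (Fin 3)))
    ![colDet x 1 2, colDet x 2 0, colDet x 0 1] Finset.univ_nonempty
  set d := Finset.univ.gcd ![colDet x 1 2, colDet x 2 0, colDet x 0 1]
  have e0 : colDet x 1 2 = d * w 0 := hw 0 (Finset.mem_univ _)
  have e1 : colDet x 2 0 = d * w 1 := hw 1 (Finset.mem_univ _)
  have e2 : colDet x 0 1 = d * w 2 := hw 2 (Finset.mem_univ _)
  have hd : d ≠ 0 := by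
    intro h
    rw [h, zero_mul] at e0
    exact h0 e0
  refine ⟨w, ?_, hg, ?_, ?_⟩
  · intro i
    fin_cases i
    · exact fun h => h0 (by rw [e0]; exact mul_eq_zero_of_right d h)
    · exact fun h => h1 (by rw [e1]; exact mul_eq_zero_of_right d h)
    · exact fun h => h2 (by rw [e2]; exact mul_eq_zero_of_right d h)
  · apply mul_left_cancel₀ hd
    rw [Fin.sum_univ_three]
    unfold colDet at e0 e1 e2
    linear_combination -(x 0).num * e0 - (x 1).num * e1 - (x 2).num * e2
  · apply mul_left_cancel₀ hd
    rw [Fin.sum_univ_three]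
    unfold colDet at e0 e1 e2
    linear_combination -((x 0).den : ℤ) * e0 - ((x 1).den : ℤ) * e1 - ((x 2).den : ℤ) * e2

theorem T1_le_ker_torusHom {x : Fin 3 → ℚ} {w : Fin 3 → ℤ} (h1 : ∑ i, w i * (x i).num = 0)
    (h2 : ∑ i, w i * ((x i).den : ℤ) = 0) : T1 w ≤ (torusHom x).ker := by
  rintro _ ⟨l, rfl⟩
  rw [MonoidHom.mem_ker, torusHom_apply]
  have key : ∀ n : Fin 3 → ℤ, ∑ i, w i * n i = 0 → ∏ i, (l ^ w i) ^ n i = 1 := by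
    intro n hn
    simp only [← zpow_mul, Fin.prod_univ_three, ← zpow_add]
    rw [← Fin.sum_univ_three (fun i => w i * n i), hn, zpow_zero]
  ext1
  · exact key _ h1
  · simpa using key _ h2

/-- The homomorphism that `torusHom x` induces on `T³ / T¹_w`. -/
def torusHomLift (x : Fin 3 → ℚ) (w : Fin 3 → ℤ) (h : T1 w ≤ (torusHom x).ker) :
    T2 w →* Circle × Circle :=
  QuotientGroup.lift (T1 w) (torusHom x) h

/-- As w₀ ≠ 0, each class in the kernel has a representative with zeroth coordinate 1. The two
equations for the other coordinates have determinant `colDet x 1 2`, so both coordinates are roots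
of unity of that order, and finitely many representatives suffice. -/
theorem finite_ker_torusHomLift {x : Fin 3 → ℚ} {w : Fin 3 → ℤ}
    (hx : x 1 ≠ x 2) (hw : w 0 ≠ 0) (h : T1 w ≤ (torusHom x).ker) :
    Finite (torusHomLift x w h).ker := by
  have hd := colDet_ne_zero hx
  have hS : (Set.pi Set.univ fun _ : Fin 3 => {c : Circle | c ^ colDet x 1 2 = 1}).Finite :=
    Set.Finite.pi fun _ => finite_circle_zpow_eq_one hd
  refine ((hS.image fun t : T3 => (t : T2 w)).subset ?_).to_subtype
  intro g hg
  obtain ⟨t, rfl⟩ := QuotientGroup.mk_surjective g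
  have ht : torusHom x t = 1 := hg
  obtain ⟨l, hl⟩ := exists_circle_zpow_eq hw (t 0)
  set s : T3 := fun i => l ^ w i
  have hs : s ∈ T1 w := ⟨l, rfl⟩
  have hs' : torusHom x s = 1 := h hs
  have hts : torusHom x (t * s⁻¹) = 1 := by rw [map_mul, map_inv, ht, hs', inv_one, mul_one]
  have h0 : (t * s⁻¹) 0 = 1 := by simp [s, hl]
  refine ⟨t * s⁻¹, ?_, ?_⟩
  · rw [torusHom_apply] at hts
    obtain ⟨e1, e2⟩ := Prod.mk.inj hts
    generalize t * s⁻¹ = r at *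
    rw [Fin.prod_univ_three, h0, one_zpow, one_mul] at e1
    rw [Fin.prod_univ_three, h0, one_pow, one_mul, ← zpow_natCast, ← zpow_natCast] at e2
    intro i _
    rw [Set.mem_ofPred_eq, colDet]
    fin_cases i
    · exact (congrArg (· ^ _) h0).trans (one_zpow _)
    · change r 1 ^ _ = 1
      -- Eliminates `r 2` from the two relations; the other case eliminates `r 1`.
      have e : (r 1 ^ (x 1).num * r 2 ^ (x 2).num) ^ ((x 2).den : ℤ) *
        ((r 1 ^ ((x 1).den : ℤ) * r 2 ^ ((x 2).den : ℤ)) ^ (x 2).num)⁻¹ = 1 := by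
        rw [e1, e2, one_zpow, one_zpow, inv_one, mul_one]
      rw [← e]
      simp only [mul_zpow, ← zpow_mul, mul_inv, ← zpow_neg]
      rw [mul_mul_mul_comm, ← zpow_add, ← zpow_add, mul_comm (x 2).num, add_neg_cancel, zpow_zero,
        mul_one, sub_eq_add_neg]
    · change r 2 ^ _ = 1
      have e : (r 1 ^ (x 1).num * r 2 ^ (x 2).num) ^ (-((x 1).den : ℤ)) *
        (r 1 ^ ((x 1).den : ℤ) * r 2 ^ ((x 2).den : ℤ)) ^ (x 1).num = 1 := by
        rw [e1, e2, one_zpow, one_zpow, mul_one]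
      rw [← e]
      simp only [mul_zpow, ← zpow_mul]
      rw [mul_mul_mul_comm, ← zpow_add, ← zpow_add,
        show (x 1).num * -((x 1).den : ℤ) + (x 1).den * (x 1).num = 0 by ring, zpow_zero, one_mul]
      congr 1
      ring
  · exact (QuotientGroup.eq.mpr (by simpa using hs)).symm

/-- The isomorphism of `(T³ / T¹_w) / Γ` with `T²` that `torusHom x` induces, for `Γ` the kernel
of `torusHomLift`. -/
def torusQuotientEquiv {x : Fin 3 → ℚ} {w : Fin 3 → ℤ} (h : T1 w ≤ (torusHom x).ker)
    (hs : Function.Surjective (torusHom x)) :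
    (T2 w ⧸ (torusHomLift x w h).ker) ≃* Circle × Circle :=
  QuotientGroup.quotientKerEquivOfSurjective (torusHomLift x w h)
    (QuotientGroup.lift_surjective_of_surjective _ _ hs h)

theorem torusQuotientEquiv_mk {x : Fin 3 → ℚ} {w : Fin 3 → ℤ} (h : T1 w ≤ (torusHom x).ker)
    (hs : Function.Surjective (torusHom x)) (t : T3) :
    torusQuotientEquiv h hs ((t : T2 w) : T2 w ⧸ (torusHomLift x w h).ker) = torusHom x t := rfl

/-- A continuous bijection from a compact space to a Hausdorff space is a homeomorphism. -/
theorem continuous_torusQuotientEquiv_symm {x : Fin 3 → ℚ} {w : Fin 3 → ℤ}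
    (h : T1 w ≤ (torusHom x).ker) (hs : Function.Surjective (torusHom x)) :
    Continuous (torusQuotientEquiv h hs).symm := by
  have hc : Continuous (torusQuotientEquiv h hs) :=
    Continuous.quotient_lift (Continuous.quotient_lift (continuous_torusHom x) _) _
  exact hc.continuous_symm_of_equiv_compact_to_t2 (f := (torusQuotientEquiv h hs).toEquiv)

end WeightedCP2
end
noncomputable section

namespace WeightedCP2

/-! ### The midpoints of the arcs -/

theorem mid_coe (j : Fin 3) : (mid j : ℂ) =
    ⟨Real.cos (2 * Real.pi * ((j : ℕ) + 1 / 2) / 3),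
      Real.sin (2 * Real.pi * ((j : ℕ) + 1 / 2) / 3)⟩ := by
  rw [mid, Circle.coe_exp]
  apply Complex.ext
  · exact Complex.exp_ofReal_mul_I_re _
  · exact Complex.exp_ofReal_mul_I_im _

theorem mid_zero : (mid 0 : ℂ) = ⟨1 / 2, √3 / 2⟩ := by
  rw [mid_coe, ← Real.cos_pi_div_three, ← Real.sin_pi_div_three]
  congr 2 <;> (simp; ring)

theorem mid_one : (mid 1 : ℂ) = ⟨-1, 0⟩ := by
  rw [mid_coe, ← Real.cos_pi, ← Real.sin_pi]
  congr 2 <;> (simp; ring)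

theorem mid_two : (mid 2 : ℂ) = ⟨1 / 2, -(√3 / 2)⟩ := by
  rw [mid_coe, ← Real.cos_pi_div_three, ← Real.sin_pi_div_three, ← Real.sin_neg,
    ← Real.cos_neg (Real.pi / 3), ← Real.cos_add_two_pi (-(Real.pi / 3)),
    ← Real.sin_add_two_pi (-(Real.pi / 3))]
  congr 2 <;> (simp; ring)

/-- The inner product of a complex number with the midpoint of the arc `J_i`. -/
def midCoord (i : Fin 3) (z : ℂ) : ℝ := z.re * (mid i : ℂ).re + z.im * (mid i : ℂ).im

theorem midCoord_real_mul (i : Fin 3) (k : ℝ) (z : ℂ) :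
    midCoord i (k * z) = k * midCoord i z := by
  simp only [midCoord, Complex.re_ofReal_mul, Complex.im_ofReal_mul]
  ring

theorem midCoord_exp (i : Fin 3) (θ : ℝ) :
    midCoord i (Circle.exp θ : ℂ) = Real.cos (θ - 2 * Real.pi * ((i : ℕ) + 1 / 2) / 3) := by
  rw [midCoord, mid_coe, Circle.coe_exp, Complex.exp_ofReal_mul_I_re, Complex.exp_ofReal_mul_I_im,
    Real.cos_sub]

/-- The three midpoints are unit vectors at angles of 120°, hence a tight frame of the plane. -/
theorem sum_midCoord_mul_mid (z : ℂ) : ∑ i, (midCoord i z : ℂ) * (mid i : ℂ) = 3 / 2 * z := by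
  have h3 : √3 * √3 = 3 := Real.mul_self_sqrt (by norm_num)
  rw [Fin.sum_univ_three]
  simp only [midCoord, mid_zero, mid_one, mid_two]
  apply Complex.ext
  · simp
    ring
  · simp
    linear_combination (z.im / 2) * h3

theorem sum_mid : ∑ i, (mid i : ℂ) = 0 := by
  rw [Fin.sum_univ_three, mid_zero, mid_one, mid_two]
  apply Complex.ext
  · norm_num
  · norm_num

/-! ### A piecewise linear map between cones -/

/-- The least absolute value of the coordinates. -/
def minNorm (v : EuclideanSpace ℂ (Fin 3)) : ℝ := min ‖v 0‖ (min ‖v 1‖ ‖v 2‖)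

theorem minNorm_le (v : EuclideanSpace ℂ (Fin 3)) (i : Fin 3) : minNorm v ≤ ‖v i‖ := by
  unfold minNorm
  fin_cases i <;> simp

theorem exists_minNorm_eq (v : EuclideanSpace ℂ (Fin 3)) : ∃ i, minNorm v = ‖v i‖ := by
  unfold minNorm
  rcases min_choice ‖v 0‖ (min ‖v 1‖ ‖v 2‖) with h | h
  · exact ⟨0, h⟩
  · rcases min_choice ‖v 1‖ ‖v 2‖ with h' | h'
    · exact ⟨1, h.trans h'⟩
    · exact ⟨2, h.trans h'⟩

theorem minNorm_nonneg (v : EuclideanSpace ℂ (Fin 3)) : 0 ≤ minNorm v := by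
  obtain ⟨i, hi⟩ := exists_minNorm_eq v
  rw [hi]
  exact norm_nonneg _

theorem minNorm_eq_of_le {v : EuclideanSpace ℂ (Fin 3)} {m : ℝ} (h : ∀ i, m ≤ ‖v i‖)
    (h' : ∃ i, ‖v i‖ = m) : minNorm v = m := by
  obtain ⟨i, hi⟩ := exists_minNorm_eq v
  obtain ⟨j, hj⟩ := h'
  exact le_antisymm (hj ▸ minNorm_le v j) (hi ▸ h i)

theorem minNorm_eq_zero_iff (v : EuclideanSpace ℂ (Fin 3)) : minNorm v = 0 ↔ ∃ i, v i = 0 := by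
  constructor
  · intro h
    obtain ⟨i, hi⟩ := exists_minNorm_eq v
    exact ⟨i, norm_eq_zero.mp (hi.symm.trans h)⟩
  · rintro ⟨i, hi⟩
    exact minNorm_eq_of_le (fun _ => norm_nonneg _) ⟨i, by rw [hi, norm_zero]⟩

/-- The product of powers of the phases of the coordinates, times their least absolute value. -/
def phaseMap (n : Fin 3 → ℕ) (v : EuclideanSpace ℂ (Fin 3)) : ℂ :=
  minNorm v * ∏ i, (v i / ‖v i‖) ^ n i

theorem norm_phaseMap (n : Fin 3 → ℕ) (v : EuclideanSpace ℂ (Fin 3)) :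
    ‖phaseMap n v‖ = minNorm v := by
  rw [phaseMap, norm_mul, Complex.norm_real, Real.norm_of_nonneg (minNorm_nonneg v)]
  by_cases h : ∃ i, v i = 0
  · rw [(minNorm_eq_zero_iff v).mpr h, zero_mul]
  · push Not at h
    rw [norm_prod, Finset.prod_eq_one, mul_one]
    intro i _
    rw [norm_pow, norm_div, Complex.norm_real, norm_norm, div_self (norm_ne_zero_iff.mpr (h i)),
      one_pow]

theorem continuous_minNorm : Continuous minNorm := by
  unfold minNorm
  fun_prop

/-- The phases are discontinuous only where a coordinate vanishes, and there the absolute value,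
which is `minNorm`, tends to 0. -/
theorem continuous_phaseMap (n : Fin 3 → ℕ) : Continuous (phaseMap n) := by
  rw [continuous_iff_continuousAt]
  intro v
  by_cases h : ∃ i, v i = 0
  · have h0 := (minNorm_eq_zero_iff v).mpr h
    have hv : phaseMap n v = 0 := by rw [← norm_eq_zero, norm_phaseMap, h0]
    rw [ContinuousAt, hv, tendsto_zero_iff_norm_tendsto_zero]
    simp only [norm_phaseMap]
    rw [← h0]
    exact continuous_minNorm.continuousAt
  · push Not at h
    unfold phaseMap
    refine ContinuousAt.mul (Complex.continuous_ofReal.comp continuous_minNorm).continuousAt ?_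
    refine tendsto_finsetProd _ fun i _ => ?_
    refine ContinuousAt.pow (ContinuousAt.div (by fun_prop) (by fun_prop) ?_) _
    exact Complex.ofReal_ne_zero.mpr (norm_ne_zero_iff.mpr (h i))

/-- The map `ℂ³ → ℂ²` that is on the absolute values the piecewise linear homeomorphism
`r ↦ (-∑ rᵢ mid i, min rᵢ)` from an octant to a half space, and on the phases a product of
powers. -/
def coneMap (n : Fin 3 → ℕ) (v : EuclideanSpace ℂ (Fin 3)) : EuclideanSpace ℂ (Fin 2) :=
  !₂[-∑ i, (‖v i‖ : ℂ) * (mid i : ℂ), phaseMap n v]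

theorem coneMap_zero (n : Fin 3 → ℕ) (v : EuclideanSpace ℂ (Fin 3)) :
    coneMap n v 0 = -∑ i, (‖v i‖ : ℂ) * (mid i : ℂ) := rfl

theorem coneMap_one (n : Fin 3 → ℕ) (v : EuclideanSpace ℂ (Fin 3)) :
    coneMap n v 1 = phaseMap n v := rfl

theorem continuous_coneMap (n : Fin 3 → ℕ) : Continuous (coneMap n) := by
  refine (PiLp.continuous_toLp 2 _).comp (continuous_pi fun i => ?_)
  fin_cases i
  · change Continuous fun v : EuclideanSpace ℂ (Fin 3) => -∑ i, (‖v i‖ : ℂ) * (mid i : ℂ)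
    fun_prop
  · exact continuous_phaseMap n

theorem coneMap_smul (n : Fin 3 → ℕ) {k : ℝ} (hk : 0 < k) (v : EuclideanSpace ℂ (Fin 3)) :
    coneMap n (k • v) = k • coneMap n v := by
  have hn : ∀ i, ‖(k • v) i‖ = k * ‖v i‖ := fun i => by
    rw [PiLp.smul_apply, norm_smul, Real.norm_of_nonneg hk.le]
  ext i
  fin_cases i
  · change coneMap n (k • v) 0 = k • coneMap n v 0
    simp only [coneMap_zero, hn, Complex.real_smul, mul_neg, Finset.mul_sum, Complex.ofReal_mul,
      mul_assoc]
  · change coneMap n (k • v) 1 = k • coneMap n v 1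
    have hm : minNorm (k • v) = k * minNorm v := by
      obtain ⟨i, hi⟩ := exists_minNorm_eq v
      refine minNorm_eq_of_le (fun j => ?_) ⟨i, by rw [hn, hi]⟩
      rw [hn]
      exact mul_le_mul_of_nonneg_left (minNorm_le v j) hk.le
    rw [coneMap_one, coneMap_one, phaseMap, phaseMap, hm, Complex.real_smul, Complex.ofReal_mul,
      mul_assoc]
    congr 3
    ext i
    rw [hn, PiLp.smul_apply, Complex.real_smul, Complex.ofReal_mul,
      mul_div_mul_left _ _ (Complex.ofReal_ne_zero.mpr hk.ne')]

/-- Distinct midpoints have inner product -1/2. Thus the first coordinate of `coneMap` records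
precisely the differences of the moduli. -/
theorem midCoord_coneMap (n : Fin 3 → ℕ) (v : EuclideanSpace ℂ (Fin 3)) (i : Fin 3) :
    midCoord i (coneMap n v 0) = (∑ j, ‖v j‖) / 2 - 3 / 2 * ‖v i‖ := by
  have h3 : √3 * √3 = 3 := Real.mul_self_sqrt (by norm_num)
  rw [coneMap_zero, Fin.sum_univ_three, Fin.sum_univ_three]
  fin_cases i
  · simp only [midCoord, mid_zero, mid_one, mid_two, Fin.zero_eta]
    simp
    linear_combination (-‖v 0‖ / 4 + ‖v 2‖ / 4) * h3
  · simp only [midCoord, mid_zero, mid_one, mid_two, Fin.mk_one]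
    simp
    ring
  · simp only [midCoord, mid_zero, mid_one, mid_two, Fin.reduceFinMk]
    simp
    linear_combination (-‖v 2‖ / 4 + ‖v 0‖ / 4) * h3

theorem norm_sub_norm (n : Fin 3 → ℕ) (v : EuclideanSpace ℂ (Fin 3)) (i j : Fin 3) :
    ‖v i‖ - ‖v j‖ = 2 / 3 * (midCoord j (coneMap n v 0) - midCoord i (coneMap n v 0)) := by
  rw [midCoord_coneMap, midCoord_coneMap]
  ring

/-- The first coordinate determines the differences of the moduli and the absolute value of the
second determines their minimum; together they determine all moduli. -/
theorem norm_apply_of_coneMap_eq_smul (n : Fin 3 → ℕ) {k : ℝ} (hk : 0 < k)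
    {v v' : EuclideanSpace ℂ (Fin 3)} (h : coneMap n v = k • coneMap n v') (i : Fin 3) :
    ‖v i‖ = k * ‖v' i‖ := by
  have hm : minNorm v = k * minNorm v' := by
    rw [← norm_phaseMap n, ← norm_phaseMap n, ← coneMap_one, h, PiLp.smul_apply, norm_smul,
      Real.norm_of_nonneg hk.le, coneMap_one]
  have hd : ∀ i j, ‖v i‖ - ‖v j‖ = k * (‖v' i‖ - ‖v' j‖) := by
    intro i j
    rw [norm_sub_norm n, norm_sub_norm n, h, PiLp.smul_apply, Complex.real_smul, midCoord_real_mul,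
      midCoord_real_mul]
    ring
  obtain ⟨a, ha⟩ := exists_minNorm_eq v
  obtain ⟨b, hb⟩ := exists_minNorm_eq v'
  -- `a` is a minimal index for `v` and `b` one for `v'`. The two sides of `h1` have opposite signs,
  -- so both vanish and `‖v a‖ = k * ‖v' a‖`; then `h2` gives the claim.
  have h1 := hd b a
  have h2 := hd i a
  have h3 := minNorm_le v b
  have h4 := mul_le_mul_of_nonneg_left (minNorm_le v' a) hk.le
  rw [hb] at hm h4
  rw [ha] at hm h3
  linarith

theorem coneMap_ne_zero (n : Fin 3 → ℕ) {v : EuclideanSpace ℂ (Fin 3)} (hv : v ≠ 0) :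
    coneMap n v ≠ 0 := by
  intro h
  apply hv
  have h0 : minNorm v = 0 := by rw [← norm_phaseMap n, ← coneMap_one, h, PiLp.zero_apply, norm_zero]
  obtain ⟨a, ha⟩ := exists_minNorm_eq v
  ext i
  have := norm_sub_norm n v i a
  rw [h, PiLp.zero_apply, ← ha, h0, sub_zero, midCoord, midCoord] at this
  rw [PiLp.zero_apply, ← norm_eq_zero, this]
  simp

/-! ### The inverse on real points -/

/-- The inverse of the piecewise linear homeomorphism `r ↦ (-∑ rᵢ mid i, min rᵢ)`. -/
def coneInv (z : ℂ) (s : ℝ) : EuclideanSpace ℂ (Fin 3) :=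
  WithLp.toLp 2 fun i => ((s + 2 / 3 *
    (max (midCoord 0 z) (max (midCoord 1 z) (midCoord 2 z)) - midCoord i z) : ℝ) : ℂ)

theorem coneInv_apply (z : ℂ) (s : ℝ) (i : Fin 3) : coneInv z s i = ((s + 2 / 3 *
    (max (midCoord 0 z) (max (midCoord 1 z) (midCoord 2 z)) - midCoord i z) : ℝ) : ℂ) := rfl

theorem continuous_coneInv : Continuous fun q : ℂ × ℝ => coneInv q.1 q.2 := by
  refine (PiLp.continuous_toLp 2 _).comp (continuous_pi fun i => ?_)
  unfold midCoord
  fun_prop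

theorem norm_coneInv (z : ℂ) {s : ℝ} (hs : 0 ≤ s) (i : Fin 3) :
    s ≤ ‖coneInv z s i‖ ∧ coneInv z s i = (‖coneInv z s i‖ : ℂ) := by
  have h : midCoord i z ≤ max (midCoord 0 z) (max (midCoord 1 z) (midCoord 2 z)) := by
    fin_cases i <;> simp
  rw [coneInv_apply, Complex.norm_real, Real.norm_of_nonneg (by linarith)]
  exact ⟨by linarith, rfl⟩

theorem minNorm_coneInv (z : ℂ) {s : ℝ} (hs : 0 ≤ s) : minNorm (coneInv z s) = s := by
  refine minNorm_eq_of_le (fun i => (norm_coneInv z hs i).1) ?_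
  have : ∃ i, max (midCoord 0 z) (max (midCoord 1 z) (midCoord 2 z)) = midCoord i z := by
    rcases max_choice (midCoord 0 z) (max (midCoord 1 z) (midCoord 2 z)) with h | h
    · exact ⟨0, h⟩
    · rcases max_choice (midCoord 1 z) (midCoord 2 z) with h' | h'
      · exact ⟨1, h.trans h'⟩
      · exact ⟨2, h.trans h'⟩
  obtain ⟨i, hi⟩ := this
  refine ⟨i, ?_⟩
  rw [coneInv_apply, hi, sub_self, mul_zero, add_zero, Complex.norm_real, Real.norm_of_nonneg hs]

theorem coneMap_coneInv (n : Fin 3 → ℕ) (z : ℂ) {s : ℝ} (hs : 0 ≤ s) :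
    coneMap n (coneInv z s) = !₂[z, (s : ℂ)] := by
  ext i
  fin_cases i
  · change coneMap n (coneInv z s) 0 = z
    rw [coneMap_zero]
    simp only [← (norm_coneInv z hs _).2]
    simp only [coneInv_apply]
    generalize max (midCoord 0 z) (max (midCoord 1 z) (midCoord 2 z)) = M
    have h1 := sum_midCoord_mul_mid z
    have h2 := sum_mid
    rw [Fin.sum_univ_three] at h1 h2 ⊢
    push_cast
    -- The part s + 2/3 M common to all coordinates drops out because the midpoints sum to zero.
    linear_combination (2 / 3 : ℂ) * h1 - (s + 2 / 3 * M : ℂ) * h2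
  · change coneMap n (coneInv z s) 1 = s
    rw [coneMap_one, phaseMap, minNorm_coneInv z hs]
    rcases hs.eq_or_lt with rfl | hs'
    · simp
    · rw [Finset.prod_eq_one, mul_one]
      intro i _
      have h := norm_coneInv z hs i
      have h0 : (‖coneInv z s i‖ : ℂ) ≠ 0 := Complex.ofReal_ne_zero.mpr (by linarith)
      rw [h.2, Complex.norm_real, norm_norm, div_self h0, one_pow]

/-! ### The map between the spheres -/

/-- The radial projection to the unit sphere. -/
def toSphere {E : Type*} [NormedAddCommGroup E] [NormedSpace ℝ E] (v : {v : E // v ≠ 0}) :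
    Metric.sphere (0 : E) 1 :=
  ⟨‖v.1‖⁻¹ • v.1, by
    rw [mem_sphere_zero_iff_norm, norm_smul, norm_inv, norm_norm,
      inv_mul_cancel₀ (norm_ne_zero_iff.mpr v.2)]⟩

theorem continuous_toSphere {E : Type*} [NormedAddCommGroup E] [NormedSpace ℝ E] :
    Continuous (toSphere (E := E)) := by
  refine Continuous.subtype_mk ?_ _
  exact (continuous_subtype_val.norm.inv₀ fun v => norm_ne_zero_iff.mpr v.2).smul
    continuous_subtype_val

theorem toSphere_eq_of_smul {E : Type*} [NormedAddCommGroup E] [NormedSpace ℝ E]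
    {u v : {v : E // v ≠ 0}} {k : ℝ} (hk : 0 < k) (h : u.1 = k • v.1) :
    toSphere u = toSphere v := by
  apply Subtype.ext
  change ‖u.1‖⁻¹ • u.1 = ‖v.1‖⁻¹ • v.1
  rw [h, norm_smul, Real.norm_of_nonneg hk.le, smul_smul, mul_inv, mul_right_comm,
    inv_mul_cancel₀ hk.ne', one_mul]

theorem toSphere_of_mem {E : Type*} [NormedAddCommGroup E] [NormedSpace ℝ E]
    (u : {v : E // v ≠ 0}) (y : Metric.sphere (0 : E) 1) (h : u.1 = y.1) : toSphere u = y := by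
  apply Subtype.ext
  change ‖u.1‖⁻¹ • u.1 = y.1
  rw [h, mem_sphere_zero_iff_norm.mp y.2, inv_one, one_smul]

theorem sphere_ne_zero {E : Type*} [NormedAddCommGroup E] (v : Metric.sphere (0 : E) 1) :
    v.1 ≠ 0 := by
  intro h
  have := v.2
  rw [h, mem_sphere_zero_iff_norm, norm_zero] at this
  exact zero_ne_one this

/-- The map `S⁵ → S³` that `coneMap` induces. -/
def sphereMap (n : Fin 3 → ℕ) (v : S5) : S3 :=
  toSphere ⟨coneMap n v.1, coneMap_ne_zero n (sphere_ne_zero v)⟩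

theorem continuous_sphereMap (n : Fin 3 → ℕ) : Continuous (sphereMap n) :=
  continuous_toSphere.comp
    (((continuous_coneMap n).comp continuous_subtype_val).subtype_mk _)

theorem sphereMap_toSphere (n : Fin 3 → ℕ) (v : {v : EuclideanSpace ℂ (Fin 3) // v ≠ 0}) :
    sphereMap n (toSphere v) = toSphere ⟨coneMap n v.1, coneMap_ne_zero n v.2⟩ :=
  toSphere_eq_of_smul (inv_pos.mpr (norm_pos_iff.mpr v.2))
    (coneMap_smul n (inv_pos.mpr (norm_pos_iff.mpr v.2)) v.1)

theorem exists_sphereMap_val (n : Fin 3 → ℕ) (v : S5) :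
    ∃ k : ℝ, 0 < k ∧ (sphereMap n v).1 = k • coneMap n v.1 :=
  ⟨_, inv_pos.mpr (norm_pos_iff.mpr (coneMap_ne_zero n (sphere_ne_zero v))), rfl⟩

theorem sphereMap_one_eq_zero_iff (n : Fin 3 → ℕ) (v : S5) :
    (sphereMap n v).1 1 = 0 ↔ ∃ i, v.1 i = 0 := by
  obtain ⟨k, hk, h⟩ := exists_sphereMap_val n v
  rw [h, PiLp.smul_apply, smul_eq_zero_iff_right hk.ne', coneMap_one, ← norm_eq_zero,
    norm_phaseMap, minNorm_eq_zero_iff]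

/-- A coordinate is the smaller, the closer the image lies to the corresponding midpoint. This
locates the vanishing coordinates over the unknot. -/
theorem norm_lt_norm_iff (n : Fin 3 → ℕ) (v : S5) (i j : Fin 3) : ‖v.1 i‖ < ‖v.1 j‖ ↔
    midCoord j ((sphereMap n v).1 0) < midCoord i ((sphereMap n v).1 0) := by
  obtain ⟨k, hk, h⟩ := exists_sphereMap_val n v
  rw [h, PiLp.smul_apply, Complex.real_smul, midCoord_real_mul, midCoord_real_mul,
    mul_lt_mul_iff_right₀ hk, ← sub_pos, norm_sub_norm n, ← sub_pos (a := midCoord i _)]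
  constructor <;> intro h <;> linarith

/-! ### Vanishing coordinates over the vertices and arcs of the unknot -/

theorem midCoord_mid (i k : Fin 3) : midCoord i (mid k) = if i = k then 1 else -1 / 2 := by
  have h3 : √3 * √3 = 3 := Real.mul_self_sqrt (by norm_num)
  unfold midCoord
  fin_cases i <;> fin_cases k <;>
    simp only [mid_zero, mid_one, mid_two, Fin.zero_eta, Fin.mk_one, Fin.reduceFinMk] <;>
    simp <;> linarith

theorem vertex_eq_neg_mid (j : Fin 3) :
    (Circle.exp (2 * Real.pi * (j : ℕ) / 3) : ℂ) = -(mid (j + 1) : ℂ) := by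
  have key : ∀ a b : ℝ, b = a + Real.pi ∨ a = b + Real.pi →
      (Circle.exp a : ℂ) = -(Circle.exp b : ℂ) := by
    rintro a b (rfl | rfl)
    · simp [Circle.coe_exp]
    · simp [Circle.coe_exp]
  apply key
  fin_cases j
  · left
    simp
    ring
  · left
    simp
    ring
  · right
    simp
    ring

/-- The j-th vertex is antipodal to `mid (j + 1)` and equally far from the other two midpoints. So
the other two coordinates tie for the minimal modulus, which is 0 over the unknot. -/
theorem eq_zero_of_isVertex (n : Fin 3 → ℕ) {v : S5} {j : Fin 3}
    (h : IsVertex j (sphereMap n v)) {i : Fin 3} (hi : i ≠ j + 1) : v.1 i = 0 := by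
  obtain ⟨h0, h1⟩ := h
  obtain ⟨a, ha⟩ := (sphereMap_one_eq_zero_iff n v).mp h1
  have key : ∀ k, midCoord k ((sphereMap n v).1 0) = -(if k = j + 1 then 1 else -1 / 2) := by
    intro k
    rw [h0, vertex_eq_neg_mid, ← midCoord_mid]
    simp only [midCoord, Complex.neg_re, Complex.neg_im]
    ring
  have hlt : ∀ i k, ‖v.1 i‖ < ‖v.1 k‖ ↔ i ≠ j + 1 ∧ k = j + 1 := by
    intro i k
    rw [norm_lt_norm_iff n, key, key]
    split_ifs with h1 h2 h2 <;> norm_num [h1, h2]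
  have hna : a ≠ j + 1 := by
    rintro rfl
    have h := (hlt i (j + 1)).mpr ⟨hi, rfl⟩
    rw [ha, norm_zero] at h
    exact (norm_nonneg _).not_gt h
  have h2 := mt (hlt a i).mp fun h => hi h.2
  rw [ha, norm_zero, not_lt] at h2
  exact norm_le_zero_iff.mp h2

/-- A point of the arc Jⱼ is closer to its own midpoint than to the others. The difference of
cosines is a product of sines of two half-angles, both in (0, π) or both in (-π, 0). -/
theorem cos_sub_mid_lt {i j : Fin 3} (h : i ≠ j) {θ : ℝ}
    (hθ : θ ∈ Set.Ioo (2 * Real.pi * (j : ℕ) / 3) (2 * Real.pi * ((j : ℕ) + 1) / 3)) :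
    Real.cos (θ - 2 * Real.pi * ((i : ℕ) + 1 / 2) / 3) <
      Real.cos (θ - 2 * Real.pi * ((j : ℕ) + 1 / 2) / 3) := by
  obtain ⟨h1, h2⟩ := hθ
  have hpi := Real.pi_pos
  rw [← sub_neg, Real.cos_sub_cos,
    show ((θ - 2 * Real.pi * ((i : ℕ) + 1 / 2) / 3) + (θ - 2 * Real.pi * ((j : ℕ) + 1 / 2) / 3)) / 2
      = θ - Real.pi * ((i : ℕ) + (j : ℕ) + 1) / 3 by ring,
    show ((θ - 2 * Real.pi * ((i : ℕ) + 1 / 2) / 3) - (θ - 2 * Real.pi * ((j : ℕ) + 1 / 2) / 3)) / 2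
      = Real.pi * ((j : ℕ) - (i : ℕ)) / 3 by ring, mul_assoc, neg_mul, neg_lt_zero]
  refine mul_pos two_pos ?_
  have key : ∀ a b : ℝ, (0 < a ∧ a < Real.pi ∧ 0 < b ∧ b < Real.pi) ∨
      (a < 0 ∧ -Real.pi < a ∧ b < 0 ∧ -Real.pi < b) → 0 < Real.sin a * Real.sin b := by
    rintro a b (⟨h1, h2, h3, h4⟩ | ⟨h1, h2, h3, h4⟩)
    · exact mul_pos (Real.sin_pos_of_pos_of_lt_pi h1 h2) (Real.sin_pos_of_pos_of_lt_pi h3 h4)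
    · exact mul_pos_of_neg_of_neg (Real.sin_neg_of_neg_of_neg_pi_lt h1 h2)
        (Real.sin_neg_of_neg_of_neg_pi_lt h3 h4)
  apply key
  have hi : (i : ℕ) < 3 := i.isLt
  have hj : (j : ℕ) < 3 := j.isLt
  have hij : (i : ℕ) ≠ j := fun hij => h (Fin.ext hij)
  generalize (i : ℕ) = a at *
  generalize (j : ℕ) = b at *
  rcases hij.lt_or_gt with hlt | hlt
  · left
    interval_cases b <;> interval_cases a <;> push_cast at h1 h2 ⊢ <;>
      refine ⟨?_, ?_, ?_, ?_⟩ <;> linarith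
  · right
    interval_cases a <;> interval_cases b <;> push_cast at h1 h2 ⊢ <;>
      refine ⟨?_, ?_, ?_, ?_⟩ <;> linarith

theorem eq_zero_iff_of_mem_arc (n : Fin 3 → ℕ) {v : S5} {j : Fin 3}
    (h : sphereMap n v ∈ arc j) (i : Fin 3) : v.1 i = 0 ↔ i = j := by
  obtain ⟨h1, θ, hθ, h0⟩ := h
  have hlt : ∀ i, i ≠ j → ‖v.1 j‖ < ‖v.1 i‖ := by
    intro i hi
    rw [norm_lt_norm_iff n, h0, midCoord_exp, midCoord_exp]
    exact cos_sub_mid_lt hi hθ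
  have hne : ∀ i, v.1 i = 0 → i = j := by
    intro i hi
    by_contra hij
    have := hlt i hij
    rw [hi, norm_zero] at this
    exact (norm_nonneg _).not_gt this
  obtain ⟨a, ha⟩ := (sphereMap_one_eq_zero_iff n v).mp h1
  exact ⟨hne i, fun h => h ▸ hne a ha ▸ ha⟩

/-! ### The fibres of the map of spheres -/

theorem exists_circle_mul_eq {a b : ℂ} (h : ‖a‖ = ‖b‖) : ∃ t : Circle, (t : ℂ) * b = a := by
  by_cases hb : b = 0
  · refine ⟨1, ?_⟩
    rw [hb, norm_zero, norm_eq_zero] at h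
    rw [h, hb, mul_zero]
  · refine ⟨⟨a / b, ?_⟩, div_mul_cancel₀ a hb⟩
    exact mem_sphere_zero_iff_norm.mpr (by rw [norm_div, h, div_self (norm_ne_zero_iff.mpr hb)])

theorem norm_torus_smul (t : T3) (v : S5) (i : Fin 3) : ‖(t • v).1 i‖ = ‖v.1 i‖ := by
  rw [torus_smul_apply, norm_mul, Circle.norm_coe, one_mul]

theorem phaseMap_torus_smul (n : Fin 3 → ℕ) (t : T3) (v : S5) :
    phaseMap n (t • v).1 = ((∏ i, t i ^ n i : Circle) : ℂ) * phaseMap n v.1 := by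
  have hc : ((∏ i, t i ^ n i : Circle) : ℂ) = ∏ i, (t i : ℂ) ^ n i := by
    simp [Fin.prod_univ_three]
  have hm : minNorm (t • v).1 = minNorm v.1 := by simp only [minNorm, norm_torus_smul]
  rw [phaseMap, phaseMap, hm, hc, mul_left_comm, ← Finset.prod_mul_distrib]
  congr 2
  ext i
  rw [norm_torus_smul, torus_smul_apply, ← mul_pow, mul_div_assoc]

theorem coneMap_torus_smul (n : Fin 3 → ℕ) (t : T3) (v : S5) : coneMap n (t • v).1 =
    !₂[coneMap n v.1 0, ((∏ i, t i ^ n i : Circle) : ℂ) * coneMap n v.1 1] := by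
  ext i
  fin_cases i
  · change coneMap n (t • v).1 0 = coneMap n v.1 0
    simp only [coneMap_zero, norm_torus_smul]
  · exact phaseMap_torus_smul n t v

/-- Equal images force equal moduli, so some t in T³ takes v' to v. If no coordinate vanishes, the
second coordinate of `coneMap` forces the product condition; otherwise the phase at a vanishing
coordinate is free and can be adjusted to satisfy it. -/
theorem sphereMap_eq_iff {n : Fin 3 → ℕ} (hn : ∀ i, n i ≠ 0) (v v' : S5) :
    sphereMap n v = sphereMap n v' ↔ ∃ t : T3, ∏ i, t i ^ n i = 1 ∧ t • v' = v := by
  constructor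
  · intro h
    obtain ⟨k, hk, e⟩ := exists_sphereMap_val n v
    obtain ⟨k', hk', e'⟩ := exists_sphereMap_val n v'
    have e1 : coneMap n v.1 = (k⁻¹ * k') • coneMap n v'.1 := by
      rw [mul_smul, ← e', ← h, e, smul_smul, inv_mul_cancel₀ hk.ne', one_smul]
    have hkk : 0 < k⁻¹ * k' := by positivity
    have hr := norm_apply_of_coneMap_eq_smul n hkk e1
    -- The moduli of v and v' are proportional, and both vectors have norm 1.
    have hk1 : k⁻¹ * k' = 1 := by
      have h1 := mem_sphere_zero_iff_norm.mp v.2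
      have h2 := mem_sphere_zero_iff_norm.mp v'.2
      rw [EuclideanSpace.norm_eq, Real.sqrt_eq_one] at h1 h2
      simp only [hr, mul_pow (k⁻¹ * k'), ← Finset.mul_sum, h2, mul_one] at h1
      exact (pow_eq_one_iff_of_nonneg hkk.le two_ne_zero).mp h1
    rw [hk1] at hr e1
    simp only [one_mul, one_smul] at hr e1
    choose t ht using fun i => exists_circle_mul_eq (hr i)
    by_cases h0 : ∃ j, v'.1 j = 0
    · obtain ⟨j, hj⟩ := h0
      obtain ⟨b, hb⟩ := exists_circle_zpow_eq (Int.natCast_ne_zero.mpr (hn j))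
        (∏ i, t i ^ n i)⁻¹
      refine ⟨Pi.mulSingle j b * t, ?_, ?_⟩
      · simp only [Pi.mul_apply, mul_pow, Finset.prod_mul_distrib]
        rw [Finset.prod_eq_single j (by simp +contextual) (by simp), Pi.mulSingle_eq_same,
          ← zpow_natCast, hb, inv_mul_cancel]
      · apply Subtype.ext
        ext i
        rw [torus_smul_apply]
        by_cases hij : i = j
        · rw [hij, hj, mul_zero, ← ht, hj, mul_zero]
        · rw [Pi.mul_apply, Pi.mulSingle_eq_of_ne hij, one_mul, ht]
    · have htv : t • v' = v := by
        apply Subtype.ext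
        ext i
        rw [torus_smul_apply, ht]
      refine ⟨t, ?_, htv⟩
      have h1 := phaseMap_torus_smul n t v'
      rw [htv, ← coneMap_one, ← coneMap_one, e1] at h1
      have h2 : coneMap n v'.1 1 ≠ 0 := by
        rw [coneMap_one, Ne, ← norm_eq_zero, norm_phaseMap, minNorm_eq_zero_iff]
        exact h0
      exact Circle.ext (mul_right_cancel₀ h2 (by rw [← h1, Circle.coe_one, one_mul]))
  · rintro ⟨t, ht, rfl⟩
    refine toSphere_eq_of_smul one_pos ?_
    change coneMap n (t • v').1 = (1 : ℝ) • coneMap n v'.1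
    rw [coneMap_torus_smul, ht, one_smul, Circle.coe_one, one_mul]
    ext i
    fin_cases i <;> rfl

theorem coneInv_ne_zero {z : ℂ} {s : ℝ} (hs : 0 ≤ s) (h : z ≠ 0 ∨ s ≠ 0) : coneInv z s ≠ 0 := by
  intro h0
  have h1 := coneMap_coneInv 0 z hs
  have h2 : coneMap 0 (0 : EuclideanSpace ℂ (Fin 3)) = 0 := by
    ext i
    fin_cases i
    · simp [coneMap]
    · simp [coneMap, phaseMap, minNorm]
  rw [h0, h2] at h1
  rcases h with h | h
  · exact h (congrArg (· 0) h1).symm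
  · exact h (Complex.ofReal_eq_zero.mp (congrArg (· 1) h1).symm)

theorem coneInv_sphere_ne_zero (y : S3) : coneInv (y.1 0) ‖y.1 1‖ ≠ 0 := by
  apply coneInv_ne_zero (norm_nonneg _)
  by_contra! h
  apply sphere_ne_zero y
  ext i
  fin_cases i
  · exact h.1
  · exact norm_eq_zero.mp h.2

/-- The point with real coordinates in the fibre of `S⁵ → S³` over `y`, up to phase. -/
def realPoint (y : S3) : S5 := toSphere ⟨coneInv (y.1 0) ‖y.1 1‖, coneInv_sphere_ne_zero y⟩

theorem continuous_realPoint : Continuous realPoint := by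
  refine continuous_toSphere.comp (Continuous.subtype_mk ?_ _)
  exact continuous_coneInv.comp (f := fun y : S3 => (y.1 0, ‖y.1 1‖)) (by fun_prop)

theorem sphereMap_smul_realPoint (n : Fin 3 → ℕ) (y : S3) (t : T3)
    (ht : ((∏ i, t i ^ n i : Circle) : ℂ) * ‖y.1 1‖ = y.1 1) :
    sphereMap n (t • realPoint y) = y := by
  have hp : 0 < ‖coneInv (y.1 0) ‖y.1 1‖‖⁻¹ :=
    inv_pos.mpr (norm_pos_iff.mpr (coneInv_sphere_ne_zero y))
  have h1 : coneMap n (realPoint y).1 =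
      ‖coneInv (y.1 0) ‖y.1 1‖‖⁻¹ • !₂[y.1 0, (‖y.1 1‖ : ℂ)] := by
    rw [← coneMap_coneInv n _ (norm_nonneg _)]
    exact coneMap_smul n hp _
  have hy := sphere_ne_zero y
  refine (toSphere_eq_of_smul (v := ⟨y.1, hy⟩) hp ?_).trans (toSphere_of_mem _ y rfl)
  change coneMap n (t • realPoint y).1 = ‖coneInv (y.1 0) ‖y.1 1‖‖⁻¹ • y.1
  rw [coneMap_torus_smul, h1]
  generalize ‖coneInv (y.1 0) ‖y.1 1‖‖⁻¹ = k
  ext i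
  fin_cases i
  · rfl
  · change ((∏ i, t i ^ n i : Circle) : ℂ) * (k • (‖y.1 1‖ : ℂ)) = k • y.1 1
    rw [mul_smul_comm, ht]

theorem sphereMap_surjective {n : Fin 3 → ℕ} (hn : ∀ i, n i ≠ 0) :
    Function.Surjective (sphereMap n) := by
  intro y
  obtain ⟨c, hc⟩ := exists_circle_mul_eq (a := y.1 1) (b := ‖y.1 1‖) (by simp)
  obtain ⟨b, hb⟩ := exists_circle_zpow_eq (Int.natCast_ne_zero.mpr (hn 0)) c
  refine ⟨Pi.mulSingle 0 b • realPoint y, sphereMap_smul_realPoint n y _ ?_⟩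
  rw [Finset.prod_eq_single 0 (by simp +contextual) (by simp), Pi.mulSingle_eq_same,
    ← zpow_natCast, hb, hc]

end WeightedCP2
end
noncomputable section

namespace WeightedCP2

/-! ### Circle actions on quotients of `S⁵` -/

/-- The circle space `X` is the quotient of `S⁵` by the kernel of `torusHom x`, and the circle acts
through the first factor of the torus `T²` that acts on this quotient. -/
structure TorusQuotient (x : Fin 3 → ℚ) (X : Type*) [TopologicalSpace X] [MulAction Circle X] where
  /-- The projection of `S⁵`. -/
  proj : S5 → X
  /-- The action of `T²`. -/
  act : Circle × Circle → X → X
  isQuotientMap_proj : Topology.IsQuotientMap proj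
  continuous_act : Continuous fun q : (Circle × Circle) × X => act q.1 q.2
  proj_eq_iff : ∀ v v', proj v = proj v' ↔ ∃ t, torusHom x t = 1 ∧ t • v' = v
  act_torusHom : ∀ t v, act (torusHom x t) (proj v) = proj (t • v)
  circle_smul : ∀ (c : Circle) (p : X), c • p = act (c, 1) p

/-- The phase of a nonzero complex number. -/
def phase (z : {z : ℂ // z ≠ 0}) : Circle :=
  ⟨z.1 / ‖z.1‖, mem_sphere_zero_iff_norm.mpr (by
    rw [norm_div, Complex.norm_real, norm_norm, div_self (norm_ne_zero_iff.mpr z.2)])⟩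

theorem phase_mul_norm (z : {z : ℂ // z ≠ 0}) : (phase z : ℂ) * ‖z.1‖ = z.1 :=
  div_mul_cancel₀ _ (Complex.ofReal_ne_zero.mpr (norm_ne_zero_iff.mpr z.2))

theorem continuous_phase : Continuous phase := by
  refine Continuous.subtype_mk ?_ _
  exact continuous_subtype_val.div (by fun_prop)
    fun z => Complex.ofReal_ne_zero.mpr (norm_ne_zero_iff.mpr z.2)

/-! ### Meridian disks lifted to the 5-sphere -/

/-- The vector in `ℂ³` whose `j`-th coordinate is `3u`, and whose other coordinates are `7`. -/
def diskVec (j : Fin 3) (u : ℂ) : EuclideanSpace ℂ (Fin 3) :=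
  WithLp.toLp 2 fun i => if i = j then 3 * u else 7

theorem diskVec_apply (j : Fin 3) (u : ℂ) (i : Fin 3) :
    diskVec j u i = if i = j then 3 * u else 7 := rfl

theorem diskVec_ne_zero (j : Fin 3) (u : ℂ) : diskVec j u ≠ 0 := by
  intro h
  have h1 : diskVec j u (j + 1) = 0 := by rw [h, PiLp.zero_apply]
  rw [diskVec_apply, if_neg (by simp)] at h1
  norm_num at h1

theorem continuous_diskVec (j : Fin 3) : Continuous (diskVec j) := by
  refine (PiLp.continuous_toLp 2 _).comp (continuous_pi fun i => ?_)
  split_ifs <;> fun_prop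

/-- A map of the complex plane to `S⁵`, whose image in `S³` over the unit disk is the disk
`V_j`. -/
def diskMap (j : Fin 3) (u : ℂ) : S5 := toSphere ⟨diskVec j u, diskVec_ne_zero j u⟩

theorem continuous_diskMap (j : Fin 3) : Continuous (diskMap j) :=
  continuous_toSphere.comp ((continuous_diskVec j).subtype_mk _)

theorem mulSingle_smul_diskMap (j : Fin 3) (c : Circle) :
    (Pi.mulSingle j c : T3) • diskMap j 1 = diskMap j c := by
  apply Subtype.ext
  ext i
  rw [torus_smul_apply]
  change _ * (‖diskVec j 1‖⁻¹ • diskVec j 1 i) = ‖diskVec j c‖⁻¹ • diskVec j c i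
  have hn : ‖diskVec j c‖ = ‖diskVec j 1‖ := by
    rw [EuclideanSpace.norm_eq, EuclideanSpace.norm_eq]
    congr 2
    ext i
    rw [diskVec_apply, diskVec_apply]
    split_ifs <;> simp [Circle.norm_coe]
  rw [hn, mul_smul_comm, diskVec_apply, diskVec_apply]
  congr 1
  by_cases h : i = j
  · subst h
    simp [mul_comm]
  · simp [h]

theorem coneMap_diskVec_zero (n : Fin 3 → ℕ) (j : Fin 3) (u : ℂ) :
    coneMap n (diskVec j u) 0 = ((7 - 3 * ‖u‖ : ℝ) : ℂ) * mid j := by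
  have h : ∀ i, (‖diskVec j u i‖ : ℂ) * (mid i : ℂ) =
      7 * (mid i : ℂ) + if i = j then (3 * ‖u‖ - 7) * (mid i : ℂ) else 0 := by
    intro i
    rw [diskVec_apply]
    split_ifs
    · simp
      ring
    · simp
  rw [coneMap_zero]
  simp only [h, Finset.sum_add_distrib, ← Finset.mul_sum, sum_mid, Finset.sum_ite_eq',
    Finset.mem_univ, if_true]
  push_cast
  ring

theorem sphereMap_diskMap_mem (n : Fin 3 → ℕ) (j : Fin 3) {u : ℂ} (hu : ‖u‖ ≤ 1) :
    sphereMap n (diskMap j u) ∈ meridianDisk j := by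
  rw [diskMap, sphereMap_toSphere]
  set y := toSphere (⟨coneMap n (diskVec j u), coneMap_ne_zero n (diskVec_ne_zero j u)⟩ :
    {v : EuclideanSpace ℂ (Fin 2) // v ≠ 0})
  have hk := inv_pos.mpr (norm_pos_iff.mpr (coneMap_ne_zero n (diskVec_ne_zero j u)))
  have hy : y.1 = ‖coneMap n (diskVec j u)‖⁻¹ • coneMap n (diskVec j u) := rfl
  generalize ‖coneMap n (diskVec j u)‖⁻¹ = k at hy hk
  have h0 : y.1 0 = ((k * (7 - 3 * ‖u‖) : ℝ) : ℂ) * mid j := by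
    rw [hy, PiLp.smul_apply, coneMap_diskVec_zero, Complex.real_smul, ← mul_assoc,
      ← Complex.ofReal_mul]
  have h7 : 4 ≤ 7 - 3 * ‖u‖ := by linarith
  have hn0 : ‖y.1 0‖ = k * (7 - 3 * ‖u‖) := by
    rw [h0, norm_mul, Circle.norm_coe, mul_one, Complex.norm_real,
      Real.norm_of_nonneg (by positivity)]
  have hn1 : ‖y.1 1‖ ≤ k * 3 := by
    rw [hy, PiLp.smul_apply, norm_smul, Real.norm_of_nonneg hk.le, coneMap_one, norm_phaseMap]
    refine mul_le_mul_of_nonneg_left ((minNorm_le _ j).trans ?_) hk.le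
    rw [diskVec_apply, if_pos rfl, norm_mul]
    norm_num
    exact hu
  refine ⟨by rw [hn0, ← h0], ?_⟩
  have h1 := mem_sphere_zero_iff_norm.mp y.2
  rw [EuclideanSpace.norm_eq, Real.sqrt_eq_one, Fin.sum_univ_two] at h1
  have h4 : k * 4 ≤ ‖y.1 0‖ := by
    rw [hn0]
    exact mul_le_mul_of_nonneg_left h7 hk.le
  -- The coordinates have absolute values at least 4k and at most 3k, with squares summing to 1.
  nlinarith [norm_nonneg (y.1 0), norm_nonneg (y.1 1)]

/-- The source of the constants 3 and 7: the inverse of the piecewise linear map takes (4/5 `mid j`,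
3/5) to 3/5 in place j and 3/5 + 2/3 · 6/5 = 7/5 elsewhere. -/
theorem realPoint_meridian (j : Fin 3) (c : Circle) :
    realPoint (meridian j c).1 = diskMap j 1 := by
  refine toSphere_eq_of_smul (k := 1 / 5) (by norm_num) ?_
  change coneInv (4 / 5 * (mid j : ℂ)) ‖3 / 5 * (c : ℂ)‖ = (1 / 5 : ℝ) • diskVec j 1
  have hs : ‖3 / 5 * (c : ℂ)‖ = 3 / 5 := by
    rw [norm_mul, Circle.norm_coe]
    norm_num
  have hm : ∀ i, midCoord i (4 / 5 * (mid j : ℂ)) = if i = j then 4 / 5 else -2 / 5 := by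
    intro i
    have := midCoord_real_mul i (4 / 5) (mid j)
    push_cast at this
    rw [this, midCoord_mid]
    split_ifs <;> norm_num
  have hM : max (if (0 : Fin 3) = j then (4 / 5 : ℝ) else -2 / 5)
      (max (if (1 : Fin 3) = j then 4 / 5 else -2 / 5) (if (2 : Fin 3) = j then 4 / 5 else -2 / 5))
      = 4 / 5 := by
    fin_cases j <;> norm_num [Fin.ext_iff]
  ext i
  rw [coneInv_apply, PiLp.smul_apply, diskVec_apply, hs, hm, hm, hm, hm, hM, Complex.real_smul]
  split_ifs <;> norm_num

theorem phase_meridian (j : Fin 3) (c : Circle) :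
    phase ⟨(meridian j c).1.1 1, (meridian j c).2⟩ = c := by
  apply Circle.ext
  change (3 / 5 * (c : ℂ)) / (‖3 / 5 * (c : ℂ)‖ : ℂ) = c
  rw [norm_mul, Circle.norm_coe]
  norm_num

theorem isQuotientMap_sphereMap {n : Fin 3 → ℕ} (hn : ∀ i, n i ≠ 0) :
    Topology.IsQuotientMap (sphereMap n) :=
  (continuous_sphereMap n).isClosedMap.isQuotientMap (continuous_sphereMap n)
    (sphereMap_surjective hn)

section QuotientMaps

variable {A B C : Type*} [TopologicalSpace A] [TopologicalSpace B] [TopologicalSpace C]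
  {f : C(A, B)} {g : C(A, C)} (hf : Topology.IsQuotientMap f) (hg : Topology.IsQuotientMap g)
  (h : ∀ a b, f a = f b ↔ g a = g b)

/-- Two quotient maps with the same fibres have homeomorphic targets. -/
def homeomorphOfQuotientMaps : B ≃ₜ C where
  toFun := hf.lift g fun a b => (h a b).mp
  invFun := hg.lift f fun a b => (h a b).mpr
  left_inv p := by
    obtain ⟨a, rfl⟩ := hf.surjective p
    have h1 := congrArg (· a) (congrArg DFunLike.coe (hf.lift_comp g fun a b => (h a b).mp))
    have h2 := congrArg (· a) (congrArg DFunLike.coe (hg.lift_comp f fun a b => (h a b).mpr))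
    exact (congrArg _ h1).trans h2
  right_inv p := by
    obtain ⟨a, rfl⟩ := hg.surjective p
    have h1 := congrArg (· a) (congrArg DFunLike.coe (hf.lift_comp g fun a b => (h a b).mp))
    have h2 := congrArg (· a) (congrArg DFunLike.coe (hg.lift_comp f fun a b => (h a b).mpr))
    exact (congrArg _ h2).trans h1
  continuous_toFun := ContinuousMap.continuous _
  continuous_invFun := ContinuousMap.continuous _

theorem homeomorphOfQuotientMaps_apply (a : A) : homeomorphOfQuotientMaps hf hg h (f a) = g a :=
  congrArg (· a) (congrArg DFunLike.coe (hf.lift_comp g fun a b => (h a b).mp))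

end QuotientMaps

/-! ### Orbit space, isotropy groups and meridians of the circle action -/

namespace TorusQuotient

variable {x : Fin 3 → ℚ} {X : Type*} [TopologicalSpace X] [MulAction Circle X]
  (Q : TorusQuotient x X)

theorem act_act (hx : Function.Surjective (torusHom x)) (a b : Circle × Circle) (p : X) :
    Q.act a (Q.act b p) = Q.act (a * b) p := by
  obtain ⟨s, rfl⟩ := hx a
  obtain ⟨t, rfl⟩ := hx b
  obtain ⟨v, rfl⟩ := Q.isQuotientMap_proj.surjective p
  rw [Q.act_torusHom, Q.act_torusHom, ← map_mul, Q.act_torusHom, mul_smul]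

theorem smul_proj (t : T3) (c : Circle) (h : torusHom x t = (c, 1)) (v : S5) :
    c • Q.proj v = Q.proj (t • v) := by
  rw [Q.circle_smul, ← h, Q.act_torusHom]

theorem smul_proj_eq_iff (hx : Function.Surjective (torusHom x)) (c : Circle) (v v' : S5) :
    c • Q.proj v' = Q.proj v ↔ ∃ t, torusHom x t = (c, 1) ∧ t • v' = v := by
  constructor
  · intro h
    obtain ⟨s, hs⟩ := hx (c, 1)
    rw [Q.smul_proj s c hs, eq_comm, Q.proj_eq_iff] at h
    obtain ⟨t, ht, h⟩ := h
    exact ⟨t * s, by rw [map_mul, ht, hs, one_mul], by rw [mul_smul, h]⟩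
  · rintro ⟨t, ht, rfl⟩
    exact Q.smul_proj t c ht v'

/-- The projection of `S⁵` to the orbit space. -/
def orbitProj (v : S5) : OrbitSpace X := Quotient.mk (MulAction.orbitRel Circle X) (Q.proj v)

theorem isQuotientMap_orbitProj : Topology.IsQuotientMap Q.orbitProj :=
  isQuotientMap_quotient_mk'.comp Q.isQuotientMap_proj

/-- Dividing also by the first factor of T² leaves the first component of `torusHom` unconstrained.
What remains is the condition ∏ tᵢ^αᵢ = 1 describing the fibres of `sphereMap`. -/
theorem orbitProj_eq_iff (hx : Function.Surjective (torusHom x)) (v v' : S5) :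
    Q.orbitProj v = Q.orbitProj v' ↔
      sphereMap (fun i => (x i).den) v = sphereMap (fun i => (x i).den) v' := by
  rw [sphereMap_eq_iff fun i => (x i).den_ne_zero]
  constructor
  · intro h
    obtain ⟨c, hc⟩ := Quotient.exact h
    obtain ⟨t, ht, h⟩ := (Q.smul_proj_eq_iff hx c v v').mp hc
    exact ⟨t, (Prod.mk.inj ht).2, h⟩
  · rintro ⟨t, ht, h⟩
    refine Quotient.sound ⟨(torusHom x t).1, ?_⟩
    exact (Q.smul_proj_eq_iff hx _ v v').mpr ⟨t, Prod.ext rfl ht, h⟩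

/-- The identification of the orbit space with `S³`. -/
def orbitHomeomorph (hx : Function.Surjective (torusHom x)) : OrbitSpace X ≃ₜ S3 :=
  homeomorphOfQuotientMaps (f := ⟨Q.orbitProj, Q.isQuotientMap_orbitProj.continuous⟩)
    (g := ⟨_, continuous_sphereMap fun i => (x i).den⟩) Q.isQuotientMap_orbitProj
    (isQuotientMap_sphereMap fun i => (x i).den_ne_zero) (Q.orbitProj_eq_iff hx)

theorem orbitHomeomorph_mk (hx : Function.Surjective (torusHom x)) (v : S5) :
    Q.orbitHomeomorph hx (Quotient.mk _ (Q.proj v)) = sphereMap (fun i => (x i).den) v :=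
  homeomorphOfQuotientMaps_apply (f := ⟨Q.orbitProj, Q.isQuotientMap_orbitProj.continuous⟩)
    (g := ⟨_, continuous_sphereMap fun i => (x i).den⟩) Q.isQuotientMap_orbitProj
    (isQuotientMap_sphereMap fun i => (x i).den_ne_zero) (Q.orbitProj_eq_iff hx) v

/-- The stabilizer of v in T³ is the j-th coordinate circle, so c fixes the point iff c = s^β with
s^α = 1. As β is prime to α, these c are all the α-th roots of unity. -/
theorem smul_eq_self_iff_of_unique_zero (hx : Function.Surjective (torusHom x)) {v : S5} {j : Fin 3}
    (hv : ∀ i, v.1 i = 0 ↔ i = j) (c : Circle) :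
    c • Q.proj v = Q.proj v ↔ c ^ (x j).den = 1 := by
  rw [Q.smul_proj_eq_iff hx]
  constructor
  · rintro ⟨t, ht, htv⟩
    have h : t = Pi.mulSingle j (t j) := by
      ext1 i
      by_cases hi : i = j
      · rw [hi, Pi.mulSingle_eq_same]
      · rw [Pi.mulSingle_eq_of_ne hi]
        have h1 := torus_smul_apply t v i
        rw [htv] at h1
        exact Circle.ext (mul_right_cancel₀ (mt (hv i).mp hi) (by rw [← h1, Circle.coe_one, one_mul]))
    rw [h, torusHom_mulSingle] at ht
    obtain ⟨h1, h2⟩ := Prod.mk.inj ht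
    rw [← h1, ← zpow_natCast, zpow_comm, zpow_natCast, h2, one_zpow]
  · intro hc
    have hg : Int.gcd (x j).num (x j).den = 1 := (x j).reduced
    have hb := Int.gcd_eq_gcd_ab (x j).num (x j).den
    rw [hg] at hb
    -- By Bézout, uβ + vα = 1; with c^α = 1 the element s = c^u satisfies s^β = c.
    refine ⟨Pi.mulSingle j (c ^ Int.gcdA (x j).num (x j).den), ?_, ?_⟩
    · rw [torusHom_mulSingle]
      ext1
      · change (c ^ _) ^ _ = c
        rw [← zpow_mul, mul_comm, eq_sub_of_add_eq hb.symm, zpow_sub, zpow_mul _ ((x j).den : ℤ),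
          Nat.cast_one, zpow_one, zpow_natCast, hc, one_zpow, inv_one, mul_one]
      · change (c ^ _) ^ _ = 1
        rw [← zpow_natCast, zpow_comm, zpow_natCast, hc, one_zpow]
    · apply Subtype.ext
      ext i
      rw [torus_smul_apply]
      by_cases hi : i = j
      · rw [(hv i).mpr hi, mul_zero]
      · rw [Pi.mulSingle_eq_of_ne hi, Circle.coe_one, one_mul]

/-- The section over the complement of the unknot that real points define. -/
def realSection : C(UnknotCompl, X) where
  toFun y := Q.act (1, phase ⟨y.1.1 1, y.2⟩) (Q.proj (realPoint y.1))
  continuous_toFun := by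
    refine Q.continuous_act.comp (Continuous.prodMk (Continuous.prodMk continuous_const ?_) ?_)
    · exact continuous_phase.comp (Continuous.subtype_mk (by fun_prop) _)
    · exact Q.isQuotientMap_proj.continuous.comp
        (continuous_realPoint.comp continuous_subtype_val)

theorem orbitHomeomorph_realSection (hx : Function.Surjective (torusHom x)) (y : UnknotCompl) :
    Q.orbitHomeomorph hx (Quotient.mk _ (Q.realSection y)) = y.1 := by
  obtain ⟨t, ht⟩ := hx (1, phase ⟨y.1.1 1, y.2⟩)
  change Q.orbitHomeomorph hx (Quotient.mk _ (Q.act (1, phase ⟨y.1.1 1, y.2⟩) _)) = y.1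
  rw [← ht, Q.act_torusHom, orbitHomeomorph_mk]
  apply sphereMap_smul_realPoint
  rw [torusHom_apply] at ht
  rw [(Prod.mk.inj ht).2]
  exact phase_mul_norm ⟨y.1.1 1, y.2⟩

/-- This is the relation m = αq + βh: rotating the j-th coordinate by c acts on the quotient as
(c^β, c^α), where c^α moves along the section and c^β along the orbit. The right side extends over
the disk. -/
theorem smul_realSection_meridian (hx : Function.Surjective (torusHom x)) (j : Fin 3) (c : Circle) :
    c ^ (x j).num • Q.realSection (meridian j (c ^ (x j).den)) = Q.proj (diskMap j c) := by
  rw [Q.circle_smul]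
  change Q.act _ (Q.act (1, phase ⟨(meridian j (c ^ (x j).den)).1.1 1, _⟩) _) = _
  rw [phase_meridian, realPoint_meridian, Q.act_act hx, Prod.mk_mul_mk, mul_one, one_mul,
    ← torusHom_mulSingle, Q.act_torusHom, mulSingle_smul_diskMap]

theorem hasInvariants (Q : TorusQuotient x X) [ContinuousSMul Circle X] (hx : ∀ i j : Fin 3, i ≠ j → x i ≠ x j) :
    ∃ o : ActionOrientation X, HasInvariants o x := by
  have hs := torusHom_surjective hx
  refine ⟨Quotient.mk _ (Q.orbitHomeomorph hs), Q.orbitHomeomorph hs, rfl, ?_, ?_, ?_,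
    Q.realSection, Q.orbitHomeomorph_realSection hs, fun j => ?_⟩
  · intro p hp
    obtain ⟨v, rfl⟩ := Q.isQuotientMap_proj.surjective p
    rw [orbitHomeomorph_mk, Ne, sphereMap_one_eq_zero_iff] at hp
    push Not at hp
    rw [eq_bot_iff]
    intro c hc
    obtain ⟨t, ht, htv⟩ := (Q.smul_proj_eq_iff hs c v v).mp hc
    have h : t = 1 := by
      ext1 i
      have h1 := torus_smul_apply t v i
      rw [htv] at h1
      exact Circle.ext (mul_right_cancel₀ (hp i) (by
        rw [← h1, Pi.one_apply, Circle.coe_one, one_mul]))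
    rw [h, map_one] at ht
    exact (Prod.mk.inj ht).1.symm
  · intro j p hp
    obtain ⟨v, rfl⟩ := Q.isQuotientMap_proj.surjective p
    rw [orbitHomeomorph_mk] at hp
    rw [eq_top_iff]
    intro c _
    have hj : j ≠ j + 2 := by fin_cases j <;> decide
    -- Over the j-th vertex the coordinates j and j + 2 vanish, so any t supported there fixes v,
    -- and the nonzero minor lets such t realize every (c, 1).
    obtain ⟨t, ht, h1⟩ := exists_torusHom_eq (hx j (j + 2) hj) (c, 1)
    refine (Q.smul_proj_eq_iff hs c v v).mpr ⟨t, ht, ?_⟩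
    apply Subtype.ext
    ext i
    rw [torus_smul_apply]
    by_cases hi : i = j + 1
    · rw [h1 i (by rw [hi]; simp) (by rw [hi]; simp), Circle.coe_one, one_mul]
    · rw [eq_zero_of_isVertex _ hp hi, mul_zero]
  · intro j p hp
    obtain ⟨v, rfl⟩ := Q.isQuotientMap_proj.surjective p
    rw [orbitHomeomorph_mk] at hp
    have : NeZero (x j).den := ⟨(x j).den_ne_zero⟩
    rw [← natCard_circle_pow_eq_one (x j).den]
    exact Nat.card_congr (Equiv.subtypeEquivRight fun c =>
      Q.smul_eq_self_iff_of_unique_zero hs (eq_zero_iff_of_mem_arc _ hp) c)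
  · refine ⟨⟨fun u => Q.proj (diskMap j u.1), Q.isQuotientMap_proj.continuous.comp
      ((continuous_diskMap j).comp continuous_subtype_val)⟩, fun u => ?_, fun c => ?_⟩
    · change Q.orbitHomeomorph hs (Quotient.mk _ (Q.proj (diskMap j u.1))) ∈ _
      rw [orbitHomeomorph_mk]
      exact sphereMap_diskMap_mem _ j (mem_closedBall_zero_iff.mp u.2)
    · exact (Q.smul_realSection_meridian hs j c).symm

end TorusQuotient

/-! ### The quotient of a weighted projective plane -/

section Construction

variable {x : Fin 3 → ℚ} {w : Fin 3 → ℤ} (h : T1 w ≤ (torusHom x).ker)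
  (hs : Function.Surjective (torusHom x))

/-- The circle in `(T³ / T¹_w) / Γ` that corresponds to the first factor of `T²`. -/
def circleHom : Circle →ₜ* (T2 w ⧸ (torusHomLift x w h).ker) where
  toMonoidHom := (torusQuotientEquiv h hs).symm.toMonoidHom.comp (MonoidHom.inl Circle Circle)
  continuous_toFun := (continuous_torusQuotientEquiv_symm h hs).comp
    (Continuous.prodMk continuous_id continuous_const)

/-- The quotient by `Γ` of the weighted projective plane, as a quotient of `S⁵`. -/
def circleSpaceTorusQuotient : TorusQuotient x (CircleSpace (circleHom h hs)) where
  proj v := Quotient.mk (MulAction.orbitRel (torusHomLift x w h).ker (CP2 w))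
    (Quotient.mk (MulAction.orbitRel (T1 w) S5) v)
  act a p := ((torusQuotientEquiv h hs).symm a • (show CP2Quotient (torusHomLift x w h).ker from p))
  isQuotientMap_proj := isQuotientMap_quotient_mk'.comp isQuotientMap_quotient_mk'
  continuous_act := by
    have : Continuous fun q : (Circle × Circle) × CP2Quotient (torusHomLift x w h).ker =>
        (torusQuotientEquiv h hs).symm q.1 • q.2 :=
      continuous_smul.comp
        (((continuous_torusQuotientEquiv_symm h hs).comp continuous_fst).prodMk continuous_snd)
    exact this
  proj_eq_iff v v' := by
    constructor
    · intro e
      obtain ⟨⟨g, hg⟩, e⟩ := Quotient.exact e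
      obtain ⟨t, rfl⟩ := QuotientGroup.mk_surjective g
      have e' : (Quotient.mk (MulAction.orbitRel (T1 w) S5) (t • v')) =
        Quotient.mk (MulAction.orbitRel (T1 w) S5) v := e
      obtain ⟨⟨s, hs⟩, e'⟩ := Quotient.exact e'.symm
      -- `t` lifts the element of Γ, and `s` in T¹_w corrects the choice of representative in the
      -- sphere.
      refine ⟨s * t, ?_, ?_⟩
      · rw [map_mul, MonoidHom.mem_ker.mp (h hs), one_mul]
        exact hg
      · rw [mul_smul]
        exact e'
    · rintro ⟨t, ht, rfl⟩
      exact Quotient.sound ⟨⟨(t : T2 w), ht⟩, rfl⟩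
  act_torusHom t v := by
    have : (torusQuotientEquiv h hs).symm (torusHom x t) =
        ((t : T2 w) : T2 w ⧸ (torusHomLift x w h).ker) := by
      rw [← torusQuotientEquiv_mk h hs, MulEquiv.symm_apply_apply]
    rw [this]
    rfl
  circle_smul c p := rfl

end Construction

end WeightedCP2
end

theorem mainTheorem6 (x : Fin 3 → ℚ) (hx : ∀ i j : Fin 3, i ≠ j → x i ≠ x j) :
    ∃ (w : Fin 3 → ℤ) (Γ : Subgroup (WeightedCP2.T2 w))
      (ρ : Circle →ₜ* (WeightedCP2.T2 w ⧸ Γ)),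
      (∀ i, w i ≠ 0) ∧ Finset.univ.gcd w = 1 ∧ Finite Γ ∧
      ∃ o : WeightedCP2.ActionOrientation (WeightedCP2.CircleSpace ρ),
        WeightedCP2.HasInvariants o x := by
  obtain ⟨w, hw, hg, h1, h2⟩ := WeightedCP2.exists_weights hx
  have h := WeightedCP2.T1_le_ker_torusHom h1 h2
  exact ⟨w, (WeightedCP2.torusHomLift x w h).ker,
    WeightedCP2.circleHom h (WeightedCP2.torusHom_surjective hx), hw, hg,
    WeightedCP2.finite_ker_torusHomLift (hx 1 2 (by decide)) (hw 0) h,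
    (WeightedCP2.circleSpaceTorusQuotient h _).hasInvariants hx⟩
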